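/- All graphs are finite and simple. The HL-networks are defined recursively: $HL_0=\{K_1\}$, and for $n\ge 1$, $HL_n$ consists (up to isomorphism) of all graphs $G_{n-1}\oplus G^*_{n-1}$ with $G_{n-1},G^*_{n-1}\in HL_{n-1}$, where $\oplus$ means taking the disjoint union of the two graphs and adding the edges of an arbitrary perfect matching between their vertex sets. For a graph $G$ and an integer $k$, a $k$-component edge cut is a set $F\subseteq E(G)$ such that $G-F$ has at least $k$ connected components, and $c\lambda_k(G)$ is the minimum size of a $k$-component edge cut of $G$. Let $e_g=\max\{|E(G_n[X])| : X\subseteq V(G_n),\ |X|=g\}$ be the maximum number of edges of a subgraph of $G_n$ induced by $g$ vertices. Theorem. Let $n\ge 8$, let $G_n\in HL_n$, and let $g$ be an integer with $0\le g\le 2^{\lceil n/2\rceil}$. Then $$c\lambda_{g+1}(G_n)=ng-e_g,$$ where, writing $g=\sum_{i=0}^{s}2^{t_i}$ with $t_0>t_1>\dots>t_s\ge 0$ (the empty sum if $g=0$), $$e_g=\sum_{i=0}^{s}t_i2^{t_i-1}+\sum_{i=0}^{s}i\,2^{t_i}.$$ -/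

import Mathlib

namespace HLNetwork

universe u

/-- The perfect matching operation `G ⊕ H`: the disjoint union of `G` and `H`, together with the
edges of a perfect matching between the two vertex sets, given by the bijection `φ`. -/
def matchingJoin {V W : Type u} (G : SimpleGraph V) (H : SimpleGraph W) (φ : V ≃ W) :
    SimpleGraph (V ⊕ W) where
  Adj
    | .inl a, .inl b => G.Adj a b
    | .inr a, .inr b => H.Adj a b
    | .inl a, .inr b => φ a = b
    | .inr b, .inl a => φ a = b
  symm := ⟨by
    rintro (a | a) (b | b) h
    · exact G.adj_symm h
    · exact h
    · exact h
    · exact H.adj_symm h⟩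
  loopless := ⟨by
    rintro (a | a) h
    · exact G.loopless.irrefl a h
    · exact H.loopless.irrefl a h⟩

/-- `IsHL n G`: the graph `G` is (isomorphic to) an `n`-dimensional HL-network.
The only `0`-dimensional one is `K₁`; those of dimension `n + 1` are the graphs obtained from two
`n`-dimensional ones by the perfect matching operation, for an arbitrary perfect matching. -/
def IsHL : (n : ℕ) → {V : Type u} → SimpleGraph V → Prop
  | 0, V, _ => Nat.card V = 1
  | n + 1, _, G => ∃ (V₁ V₂ : Type u) (G₁ : SimpleGraph V₁) (G₂ : SimpleGraph V₂) (φ : V₁ ≃ V₂),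
      IsHL n G₁ ∧ IsHL n G₂ ∧ Nonempty (G ≃g matchingJoin G₁ G₂ φ)

/-- `F` is a `k`-component edge cut of `G`: a set of edges of `G` whose deletion leaves a graph
with at least `k` connected components. -/
def IsComponentEdgeCut {V : Type u} (G : SimpleGraph V) (k : ℕ) (F : Set (Sym2 V)) : Prop :=
  F ⊆ G.edgeSet ∧ k ≤ Nat.card (G.deleteEdges F).ConnectedComponent

/-- The `k`-component edge connectivity of the finite graph `G`: the minimum size of a
`k`-component edge cut. -/
noncomputable def componentEdgeConnectivity {V : Type u} (G : SimpleGraph V) (k : ℕ) : ℕ :=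
  sInf {m | ∃ F : Set (Sym2 V), IsComponentEdgeCut G k F ∧ F.ncard = m}

/-- `e_g` of the finite graph `G`: the maximum number of edges of a subgraph of `G` induced by a
set of `g` vertices. -/
noncomputable def maxInducedEdges {V : Type u} (G : SimpleGraph V) (g : ℕ) : ℕ :=
  sSup {m | ∃ X : Finset V, X.card = g ∧ (G.induce (X : Set V)).edgeSet.ncard = m}

/-- The exponents `t₀ > t₁ > ⋯ > t_s` in the binary expansion `g = 2 ^ t₀ + ⋯ + 2 ^ t_s`. -/
def binaryExponents (g : ℕ) : List ℕ := g.bitIndices.reverse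

/-- `∑ i, t_i * 2 ^ (t_i - 1) + ∑ i, i * 2 ^ t_i`, where `g = 2 ^ t₀ + ⋯ + 2 ^ t_s` with
`t₀ > ⋯ > t_s` (a term with `t_i = 0` contributes `0` to the first sum). -/
def binaryEdgeCount (g : ℕ) : ℕ :=
  ∑ i : Fin (binaryExponents g).length,
      (binaryExponents g)[i] * 2 ^ ((binaryExponents g)[i] - 1) +
    ∑ i : Fin (binaryExponents g).length, (i : ℕ) * 2 ^ (binaryExponents g)[i]

/-- An `n`-dimensional HL-network has `2 ^ n` vertices (in particular, it is finite). -/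
theorem IsHL.card_eq {n : ℕ} {V : Type u} {G : SimpleGraph V} (h : IsHL n G) :
    Nat.card V = 2 ^ n := by
  induction n generalizing V with
  | zero => simpa [IsHL] using h
  | succ n ih =>
    obtain ⟨V₁, V₂, G₁, G₂, φ, h₁, h₂, ⟨e⟩⟩ := h
    have c₁ := ih h₁
    have c₂ := ih h₂
    have : Finite V₁ := Nat.finite_of_card_ne_zero (by rw [c₁]; positivity)
    have : Finite V₂ := Nat.finite_of_card_ne_zero (by rw [c₂]; positivity)
    rw [Nat.card_congr e.toEquiv, Nat.card_sum, c₁, c₂]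
    ring

/-- The minimum in the definition of the component edge connectivity is attained as soon as
`G` has at least `k` vertices. -/
theorem componentEdgeConnectivity_isLeast {V : Type u} (G : SimpleGraph V) {k : ℕ}
    (hk : k ≤ Nat.card V) :
    IsLeast {m | ∃ F : Set (Sym2 V), IsComponentEdgeCut G k F ∧ F.ncard = m}
      (componentEdgeConnectivity G k) := by
  refine ⟨Nat.sInf_mem ⟨_, G.edgeSet, ⟨subset_rfl, ?_⟩, rfl⟩, fun m hm => Nat.sInf_le hm⟩
  have hbot : G.deleteEdges G.edgeSet = ⊥ := by simp
  rw [hbot]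
  refine hk.trans (le_of_eq (Nat.card_congr (Equiv.ofBijective
    (SimpleGraph.connectedComponentMk ⊥) ⟨fun a b h => ?_, Quot.mk_surjective⟩)))
  exact SimpleGraph.reachable_bot.mp (SimpleGraph.ConnectedComponent.exact h)

/-- The maximum in the definition of `e_g` is attained as soon as `G` has at least `g` vertices. -/
theorem maxInducedEdges_isGreatest {V : Type u} [Finite V] (G : SimpleGraph V) {g : ℕ}
    (hg : g ≤ Nat.card V) :
    IsGreatest {m | ∃ X : Finset V, X.card = g ∧ (G.induce (X : Set V)).edgeSet.ncard = m}
      (maxInducedEdges G g) := by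
  have := Fintype.ofFinite V
  have hfin : {m | ∃ X : Finset V, X.card = g ∧
      (G.induce (X : Set V)).edgeSet.ncard = m}.Finite :=
    (Set.finite_range fun X : Finset V => (G.induce (X : Set V)).edgeSet.ncard).subset
      (by rintro m ⟨X, -, rfl⟩; exact ⟨X, rfl⟩)
  rw [Nat.card_eq_fintype_card] at hg
  obtain ⟨X, -, hX⟩ := Finset.exists_subset_card_eq (s := (Finset.univ : Finset V)) hg
  exact ⟨Nat.sSup_mem ⟨_, X, hX, rfl⟩ hfin.bddAbove, fun m hm => le_csSup hfin.bddAbove hm⟩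

end HLNetwork

/-!
Write `f g` for `binaryEdgeCount g` and `s k` for the number of ones in the binary expansion of
`k`; then `f g = ∑ k < g, s k` (`binaryEdgeCount_succ`). Three properties of `f` carry the proof.

* Superadditivity, `f a + f b + min a b ≤ f (a + b)` (`binaryEdgeCount_add_min_le`). In a matching
  join the two parts of a vertex set, of sizes `a` and `b`, span at most `min a b` matching edges,
  so by induction on `n` every set of `g` vertices of an HL-network spans at most `f g` edges. A set
  attaining `f g` is obtained by filling one half first and continuing in the other half, thanks to
  `f (2 ^ t + r) = f (2 ^ t) + f r + r` for `r ≤ 2 ^ t`. Hence `e_g = f g`.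
* Concentration, `f (a + 1) + f (b + 1) ≤ f (a + b + 1)`, which follows from superadditivity and
  `s b ≤ b`. So among all partitions of `N` vertices into at least `g + 1` nonempty classes, the sum
  of `f` over the class sizes is at most `f (N - g)`, the value for `g` singletons and one big class.
* Reflection, `f (2 ^ n) + f g = f (2 ^ n - g) + n * g`, because `s (2 ^ n - 1 - k) = n - s k`.

If deleting `F` leaves at least `g + 1` components, then the remaining edges lie inside the
components, so there are at most `f (2 ^ n - g)` of them, while `G` has `f (2 ^ n)` edges. Thus
`|F| ≥ f (2 ^ n) - f (2 ^ n - g) = n * g - f g`. Equality holds when `F` consists of the edges not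
lying inside an optimal set of `2 ^ n - g` vertices. This works for every `g < 2 ^ n`.
-/

namespace HLNetwork

open Finset

/-! ### Binary digit sums -/

/-- The number of ones in the binary expansion of `k`. -/
def binaryWeight (k : ℕ) : ℕ := k.bitIndices.length

lemma binaryWeight_two_mul (m : ℕ) : binaryWeight (2 * m) = binaryWeight m := by
  simp [binaryWeight, Nat.bitIndices_two_mul]

lemma binaryWeight_two_mul_add_one (m : ℕ) :
    binaryWeight (2 * m + 1) = binaryWeight m + 1 := by
  simp [binaryWeight, Nat.bitIndices_two_mul_add_one]

lemma binaryWeight_le (k : ℕ) : binaryWeight k ≤ k := by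
  induction k using Nat.strong_induction_on with
  | _ k ih =>
    obtain ⟨m, rfl | rfl⟩ := k.even_or_odd'
    · rcases Nat.eq_zero_or_pos m with rfl | hm
      · simp [binaryWeight]
      · have := ih m (by omega)
        rw [binaryWeight_two_mul]; omega
    · have := ih m (by omega)
      rw [binaryWeight_two_mul_add_one]; omega

lemma binaryWeight_reflect (n : ℕ) {k : ℕ} (hk : k < 2 ^ n) :
    binaryWeight (2 ^ n - 1 - k) + binaryWeight k = n := by
  induction n generalizing k with
  | zero =>
    obtain rfl : k = 0 := by simpa using hk
    simp [binaryWeight]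
  | succ n ih =>
    rw [pow_succ] at hk ⊢
    obtain ⟨m, rfl | rfl⟩ := k.even_or_odd'
    · have := ih (k := m) (by omega)
      rw [show 2 ^ n * 2 - 1 - 2 * m = 2 * (2 ^ n - 1 - m) + 1 by omega,
        binaryWeight_two_mul_add_one, binaryWeight_two_mul]
      omega
    · have := ih (k := m) (by omega)
      rw [show 2 ^ n * 2 - 1 - (2 * m + 1) = 2 * (2 ^ n - 1 - m) by omega,
        binaryWeight_two_mul_add_one, binaryWeight_two_mul]
      omega

lemma binaryWeight_two_pow_add (t : ℕ) {r : ℕ} (hr : r < 2 ^ t) :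
    binaryWeight (2 ^ t + r) = binaryWeight r + 1 := by
  induction t generalizing r with
  | zero =>
    obtain rfl : r = 0 := by simpa using hr
    exact binaryWeight_two_mul_add_one 0
  | succ t ih =>
    rw [pow_succ] at hr ⊢
    obtain ⟨m, rfl | rfl⟩ := r.even_or_odd'
    · rw [show 2 ^ t * 2 + 2 * m = 2 * (2 ^ t + m) by ring, binaryWeight_two_mul,
        binaryWeight_two_mul, ih (by omega)]
    · rw [show 2 ^ t * 2 + (2 * m + 1) = 2 * (2 ^ t + m) + 1 by ring,
        binaryWeight_two_mul_add_one, binaryWeight_two_mul_add_one, ih (by omega)]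

/-! ### The function `binaryEdgeCount` -/

/-- The expression defining `binaryEdgeCount`, for an arbitrary list of exponents. -/
def exponentSum (l : List ℕ) : ℕ :=
  ∑ i : Fin l.length, l[i] * 2 ^ (l[i] - 1) + ∑ i : Fin l.length, (i : ℕ) * 2 ^ l[i]

lemma exponentSum_concat_zero (l : List ℕ) : exponentSum (l ++ [0]) = exponentSum l + l.length := by
  have h (F : ℕ → ℕ → ℕ) : ∑ i : Fin (l ++ [0]).length, F i (l ++ [0])[i] =
      ∑ i : Fin l.length, F i l[i] + F l.length 0 := by
    have e : l.length + 1 = (l ++ [0]).length := by simp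
    rw [← Fin.sum_congr' _ e, Fin.sum_univ_castSucc]
    simp
  unfold exponentSum
  rw [h fun _ t => t * 2 ^ (t - 1), h fun i t => i * 2 ^ t]
  simp; ring

lemma exponentSum_map_succ (l : List ℕ) :
    exponentSum (l.map (· + 1)) = 2 * exponentSum l + (l.map (2 ^ ·)).sum := by
  have h (F : ℕ → ℕ → ℕ) : ∑ i : Fin (l.map (· + 1)).length, F i (l.map (· + 1))[i] =
      ∑ i : Fin l.length, F i (l[i] + 1) := by
    have e : l.length = (l.map (· + 1)).length := by simp
    rw [← Fin.sum_congr' _ e]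
    simp
  have hs : (l.map (2 ^ ·)).sum = ∑ i : Fin l.length, 2 ^ l[i] :=
    (Fin.sum_univ_fun_getElem l (2 ^ ·)).symm
  unfold exponentSum
  rw [h fun _ t => t * 2 ^ (t - 1), h fun i t => i * 2 ^ t, hs, mul_add, mul_sum, mul_sum,
    ← sum_add_distrib, ← sum_add_distrib, ← sum_add_distrib]
  refine sum_congr rfl fun i _ => ?_
  rcases l[i] with _ | t
  · simp; ring
  · simp only [Nat.add_sub_cancel, pow_succ]; ring

lemma binaryEdgeCount_eq (g : ℕ) : binaryEdgeCount g = exponentSum g.bitIndices.reverse := rfl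

lemma binaryEdgeCount_two_mul (m : ℕ) :
    binaryEdgeCount (2 * m) = 2 * binaryEdgeCount m + m := by
  rw [binaryEdgeCount_eq, Nat.bitIndices_two_mul, ← List.map_reverse, exponentSum_map_succ,
    List.map_reverse, List.sum_reverse, Nat.sum_map_two_pow_bitIndices, binaryEdgeCount_eq]

lemma binaryEdgeCount_two_mul_add_one (m : ℕ) :
    binaryEdgeCount (2 * m + 1) = 2 * binaryEdgeCount m + m + binaryWeight m := by
  rw [← binaryEdgeCount_two_mul, binaryEdgeCount_eq, Nat.bitIndices_two_mul_add_one,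
    List.reverse_cons, exponentSum_concat_zero, binaryEdgeCount_eq, Nat.bitIndices_two_mul]
  simp [binaryWeight]

lemma binaryEdgeCount_zero : binaryEdgeCount 0 = 0 := by
  have := binaryEdgeCount_two_mul 0
  simp only [mul_zero] at this
  omega

lemma binaryEdgeCount_succ (k : ℕ) :
    binaryEdgeCount (k + 1) = binaryEdgeCount k + binaryWeight k := by
  induction k using Nat.strong_induction_on with
  | _ k ih =>
    obtain ⟨m, rfl | rfl⟩ := k.even_or_odd'
    · rw [binaryEdgeCount_two_mul_add_one, binaryEdgeCount_two_mul, binaryWeight_two_mul]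
    · rw [show 2 * m + 1 + 1 = 2 * (m + 1) by ring, binaryEdgeCount_two_mul, ih m (by omega),
        binaryEdgeCount_two_mul_add_one, binaryWeight_two_mul_add_one]
      ring

lemma binaryEdgeCount_one : binaryEdgeCount 1 = 0 := by
  simpa [binaryEdgeCount_zero, binaryWeight] using binaryEdgeCount_succ 0

lemma binaryEdgeCount_mono : Monotone binaryEdgeCount :=
  monotone_nat_of_le_succ fun k => by rw [binaryEdgeCount_succ]; omega

lemma binaryEdgeCount_two_mul_add_one' (m : ℕ) :
    binaryEdgeCount (2 * m + 1) = binaryEdgeCount m + binaryEdgeCount (m + 1) + m := by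
  rw [binaryEdgeCount_two_mul_add_one, binaryEdgeCount_succ]; ring

/-- Superadditivity of `binaryEdgeCount`. Halving both arguments preserves the shape of the
inequality, whatever their parities. -/
lemma binaryEdgeCount_add_min_le (a b : ℕ) :
    binaryEdgeCount a + binaryEdgeCount b + min a b ≤ binaryEdgeCount (a + b) := by
  induction h : a + b using Nat.strong_induction_on generalizing a b with
  | _ N ih =>
    subst h
    rcases Nat.lt_or_ge (a + b) 2 with hs | hs
    · have : a = 0 ∨ b = 0 := by omega
      rcases this with rfl | rfl <;> simp [binaryEdgeCount_zero]
    obtain ⟨x, rfl | rfl⟩ := a.even_or_odd' <;> obtain ⟨y, rfl | rfl⟩ := b.even_or_odd'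
    · have h1 := ih (x + y) (by omega) x y rfl
      rw [← mul_add]
      simp only [binaryEdgeCount_two_mul]
      omega
    · have h1 := ih (x + y) (by omega) x y rfl
      have h2 := ih (x + (y + 1)) (by omega) x (y + 1) rfl
      rw [show 2 * x + (2 * y + 1) = 2 * (x + y) + 1 by ring]
      simp only [binaryEdgeCount_two_mul, binaryEdgeCount_two_mul_add_one']
      rw [← add_assoc] at h2
      omega
    · have h1 := ih (x + y) (by omega) x y rfl
      have h2 := ih (x + 1 + y) (by omega) (x + 1) y rfl
      rw [show 2 * x + 1 + 2 * y = 2 * (x + y) + 1 by ring]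
      simp only [binaryEdgeCount_two_mul, binaryEdgeCount_two_mul_add_one']
      rw [Nat.add_right_comm x 1 y] at h2
      omega
    · -- The two odd arguments share their extra units crosswise.
      rcases Nat.eq_zero_or_pos (x + y) with h0 | h0
      · obtain ⟨rfl, rfl⟩ : x = 0 ∧ y = 0 := by omega
        have := binaryEdgeCount_two_mul 1
        simp only [mul_zero, zero_add, binaryEdgeCount_one, mul_one] at this ⊢
        simp [this]
      have h1 := ih (x + (y + 1)) (by omega) x (y + 1) rfl
      have h2 := ih (x + 1 + y) (by omega) (x + 1) y rfl
      rw [show 2 * x + 1 + (2 * y + 1) = 2 * (x + y + 1) by ring]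
      simp only [binaryEdgeCount_two_mul, binaryEdgeCount_two_mul_add_one']
      rw [Nat.add_right_comm x 1 y] at h2
      rw [← add_assoc] at h1
      omega

/-- Moving all but one element of a class of size `b + 1` to a class of size `a + 1` does not
decrease the sum of `binaryEdgeCount`; the remaining singleton contributes `0`. -/
lemma binaryEdgeCount_concentrate (a b : ℕ) :
    binaryEdgeCount (a + 1) + binaryEdgeCount (b + 1) ≤ binaryEdgeCount (a + b + 1) := by
  wlog h : b ≤ a generalizing a b
  · have := this b a (by omega)
    rwa [add_comm a b, add_comm (binaryEdgeCount (a + 1))]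
  have h1 := binaryEdgeCount_add_min_le (a + 1) b
  have h2 := binaryWeight_le b
  rw [binaryEdgeCount_succ b]
  rw [Nat.add_right_comm a 1 b] at h1
  omega

lemma sum_binaryEdgeCount_succ_le {ι : Type*} (s : Finset ι) (x : ι → ℕ) :
    ∑ i ∈ s, binaryEdgeCount (x i + 1) ≤ binaryEdgeCount (∑ i ∈ s, x i + 1) := by
  classical
  induction s using Finset.induction_on with
  | empty => simp
  | insert i s hi ih =>
    rw [sum_insert hi, sum_insert hi]
    exact (Nat.add_le_add_left ih _).trans (binaryEdgeCount_concentrate _ _)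

lemma binaryEdgeCount_two_pow_add (t : ℕ) {r : ℕ} (hr : r ≤ 2 ^ t) :
    binaryEdgeCount (2 ^ t + r) = binaryEdgeCount (2 ^ t) + binaryEdgeCount r + r := by
  induction r with
  | zero => simp [binaryEdgeCount_zero]
  | succ r ih =>
    rw [← add_assoc, binaryEdgeCount_succ, ih (by omega), binaryEdgeCount_succ,
      binaryWeight_two_pow_add t (by omega)]
    ring

lemma binaryEdgeCount_reflect (n : ℕ) {g : ℕ} (hg : g ≤ 2 ^ n) :
    binaryEdgeCount (2 ^ n) + binaryEdgeCount g = binaryEdgeCount (2 ^ n - g) + n * g := by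
  induction g with
  | zero => simp [binaryEdgeCount_zero]
  | succ g ih =>
    have h1 := ih (by omega)
    have h2 := binaryWeight_reflect n (k := g) (by omega)
    have h3 := binaryEdgeCount_succ (2 ^ n - 1 - g)
    rw [show 2 ^ n - 1 - g + 1 = 2 ^ n - g by omega] at h3
    rw [binaryEdgeCount_succ, mul_add, show 2 ^ n - (g + 1) = 2 ^ n - 1 - g by omega]
    omega

/-! ### Counting adjacent pairs -/

universe u

variable {V W : Type*}

open Classical in
/-- The number of ordered pairs of adjacent vertices of `X`, that is, twice the number of edges
spanned by `X`. -/
noncomputable def adjPairs (G : SimpleGraph V) (X : Finset V) : ℕ :=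
  ∑ u ∈ X, ∑ v ∈ X, if G.Adj u v then 1 else 0

lemma adjPairs_univ [Fintype V] (G : SimpleGraph V) :
    adjPairs G univ = 2 * G.edgeSet.ncard := by
  classical
  rw [← SimpleGraph.coe_edgeFinset, Set.ncard_coe_finset,
    ← SimpleGraph.sum_degrees_eq_twice_card_edges]
  refine sum_congr rfl fun u _ => ?_
  rw [← SimpleGraph.card_neighborFinset_eq_degree, SimpleGraph.neighborFinset_eq_filter,
    card_filter]

lemma adjPairs_eq_induce (G : SimpleGraph V) (X : Finset V) :
    adjPairs G X = 2 * (G.induce (X : Set V)).edgeSet.ncard := by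
  classical
  rw [← adjPairs_univ]
  unfold adjPairs
  rw [← sum_coe_sort X]
  refine sum_congr rfl fun u _ => ?_
  rw [← sum_coe_sort X]
  rfl

lemma adjPairs_map {G : SimpleGraph V} {H : SimpleGraph W} (e : G ≃g H) (X : Finset V) :
    adjPairs H (X.map e.toEquiv.toEmbedding) = adjPairs G X := by
  classical
  simp only [adjPairs, sum_map]
  refine sum_congr rfl fun u _ => sum_congr rfl fun v _ => ?_
  exact if_congr e.map_adj_iff rfl rfl

open Classical in
lemma adjPairs_matchingJoin {V W : Type u} (G : SimpleGraph V) (H : SimpleGraph W) (φ : V ≃ W)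
    (A : Finset V) (B : Finset W) :
    adjPairs (matchingJoin G H φ) (A.disjSum B) =
      adjPairs G A + adjPairs H B + 2 * #{a ∈ A | φ a ∈ B} := by
  set J := matchingJoin G H φ
  have h1 : ∑ a ∈ A, ∑ b ∈ B, (if J.Adj (.inl a) (.inr b) then 1 else 0) =
      #{a ∈ A | φ a ∈ B} := by
    rw [card_filter]
    exact sum_congr rfl fun a _ =>
      (sum_congr rfl fun b _ => if_congr Iff.rfl rfl rfl).trans (sum_ite_eq B (φ a) _)
  have h2 : ∑ b ∈ B, ∑ a ∈ A, (if J.Adj (.inr b) (.inl a) then 1 else 0) =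
      #{a ∈ A | φ a ∈ B} := by
    rw [sum_comm, ← h1]
    exact sum_congr rfl fun a _ => sum_congr rfl fun b _ => if_congr (J.adj_comm _ _) rfl rfl
  have h3 : ∑ a ∈ A, ∑ a' ∈ A, (if J.Adj (.inl a) (.inl a') then 1 else 0) = adjPairs G A := rfl
  have h4 : ∑ b ∈ B, ∑ b' ∈ B, (if J.Adj (.inr b) (.inr b') then 1 else 0) = adjPairs H B := rfl
  rw [adjPairs]
  simp only [sum_disjSum, sum_add_distrib, h1, h2, h3, h4]
  ring

open Classical in
lemma card_filter_matching_le (φ : V ≃ W) (A : Finset V) (B : Finset W) :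
    #{a ∈ A | φ a ∈ B} ≤ min #A #B :=
  le_min (card_filter_le _ _) (card_le_card_of_injOn φ (by simp [Set.MapsTo]) φ.injective.injOn)

/-! ### Edges spanned by vertex sets of HL-networks -/

lemma IsHL.finite {n : ℕ} {V : Type*} {G : SimpleGraph V} (h : IsHL n G) : Finite V :=
  Nat.finite_of_card_ne_zero (by rw [h.card_eq]; positivity)

lemma IsHL.adjPairs_le {n : ℕ} {V : Type*} {G : SimpleGraph V} (h : IsHL n G) (X : Finset V) :
    adjPairs G X ≤ 2 * binaryEdgeCount #X := by
  classical
  induction n generalizing V with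
  | zero =>
    have : Subsingleton V := (Nat.card_eq_one_iff_unique.mp h).1
    have h0 : adjPairs G X = 0 :=
      sum_eq_zero fun u _ => sum_eq_zero fun v _ => if_neg fun hv => hv.ne (Subsingleton.elim _ _)
    omega
  | succ n ih =>
    obtain ⟨V₁, V₂, G₁, G₂, φ, h₁, h₂, ⟨e⟩⟩ := h
    rw [← adjPairs_map e, ← card_map e.toEquiv.toEmbedding]
    generalize X.map e.toEquiv.toEmbedding = Y
    have hc := card_toLeft_add_card_toRight (u := Y)
    have hY := adjPairs_matchingJoin G₁ G₂ φ Y.toLeft Y.toRight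
    rw [toLeft_disjSum_toRight] at hY
    have i₁ := ih h₁ Y.toLeft
    have i₂ := ih h₂ Y.toRight
    have hm := card_filter_matching_le φ Y.toLeft Y.toRight
    have hs := binaryEdgeCount_add_min_le #Y.toLeft #Y.toRight
    rw [hc] at hs
    omega

lemma IsHL.exists_adjPairs_eq {n : ℕ} {V : Type*} {G : SimpleGraph V} (h : IsHL n G) {g : ℕ}
    (hg : g ≤ 2 ^ n) : ∃ X : Finset V, #X = g ∧ adjPairs G X = 2 * binaryEdgeCount g := by
  classical
  induction n generalizing V g with
  | zero =>
    obtain ⟨_, ⟨v⟩⟩ := Nat.card_eq_one_iff_unique.mp h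
    have hg' : g = 0 ∨ g = 1 := by rw [pow_zero] at hg; omega
    rcases hg' with rfl | rfl
    · exact ⟨∅, by simp [adjPairs, binaryEdgeCount_zero]⟩
    · exact ⟨{v}, by simp [adjPairs, binaryEdgeCount_one]⟩
  | succ n ih =>
    obtain ⟨V₁, V₂, G₁, G₂, φ, h₁, h₂, ⟨e⟩⟩ := h
    suffices ∃ Y : Finset (V₁ ⊕ V₂), #Y = g ∧
        adjPairs (matchingJoin G₁ G₂ φ) Y = 2 * binaryEdgeCount g by
      obtain ⟨Y, hY, hY'⟩ := this
      exact ⟨Y.map e.symm.toEquiv.toEmbedding, by rw [card_map, hY], by rw [adjPairs_map, hY']⟩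
    rcases Nat.lt_or_ge (2 ^ n) g with hlt | hle
    · have hr : g - 2 ^ n ≤ 2 ^ n := by rw [pow_succ] at hg; omega
      obtain ⟨A, hA, hA'⟩ := ih h₁ le_rfl
      obtain ⟨B, hB, hB'⟩ := ih h₂ hr
      have := h₁.finite
      have := Fintype.ofFinite V₁
      obtain rfl : A = univ := by
        rw [← card_eq_iff_eq_univ, hA, ← Nat.card_eq_fintype_card, h₁.card_eq]
      have hcross : #{a ∈ univ | φ a ∈ B} = #B := by
        rw [← card_map φ.symm.toEmbedding]
        congr 1
        ext a
        simp
      have hsum := binaryEdgeCount_two_pow_add n hr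
      rw [show 2 ^ n + (g - 2 ^ n) = g by omega] at hsum
      refine ⟨univ.disjSum B, by rw [card_disjSum]; omega, ?_⟩
      rw [adjPairs_matchingJoin, hcross]
      omega
    · obtain ⟨A, hA, hA'⟩ := ih h₁ hle
      exact ⟨A.disjSum ∅, by simp [hA], by rw [adjPairs_matchingJoin, hA']; simp [adjPairs]⟩

lemma IsHL.ncard_edgeSet {n : ℕ} {V : Type*} {G : SimpleGraph V} (h : IsHL n G) :
    G.edgeSet.ncard = binaryEdgeCount (2 ^ n) := by
  have := h.finite
  have := Fintype.ofFinite V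
  obtain ⟨X, hX, hX'⟩ := h.exists_adjPairs_eq le_rfl
  obtain rfl : X = univ := by
    rw [← card_eq_iff_eq_univ, hX, ← Nat.card_eq_fintype_card, h.card_eq]
  rw [adjPairs_univ] at hX'
  omega

lemma IsHL.maxInducedEdges_eq {n : ℕ} {V : Type*} {G : SimpleGraph V} (h : IsHL n G) {g : ℕ}
    (hg : g ≤ 2 ^ n) : maxInducedEdges G g = binaryEdgeCount g := by
  have := h.finite
  obtain ⟨⟨X, hX, hX'⟩, hmax⟩ := maxInducedEdges_isGreatest G (g := g) (by rwa [h.card_eq])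
  apply le_antisymm
  · have h1 := h.adjPairs_le X
    rw [adjPairs_eq_induce, hX', hX] at h1
    omega
  · obtain ⟨Y, hY, hY'⟩ := h.exists_adjPairs_eq hg
    rw [adjPairs_eq_induce] at hY'
    exact hmax ⟨Y, hY, by omega⟩

/-! ### Component edge cuts -/

lemma ncard_edgeSet_deleteEdges_add [Finite V] (G : SimpleGraph V) {F : Set (Sym2 V)}
    (hF : F ⊆ G.edgeSet) : (G.deleteEdges F).edgeSet.ncard + F.ncard = G.edgeSet.ncard := by
  rw [SimpleGraph.edgeSet_deleteEdges]
  exact Set.ncard_sdiff_add_ncard_of_subset hF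

/-- A spanning subgraph of an HL-network with more than `g` components has no more edges than
the largest number spanned by `2 ^ n - g` vertices. -/
lemma IsHL.ncard_edgeSet_le_of_lt_card_components {n : ℕ} {V : Type*} {G : SimpleGraph V}
    (h : IsHL n G) {H : SimpleGraph V} (hH : H ≤ G) {g : ℕ}
    (hg : g + 1 ≤ Nat.card H.ConnectedComponent) :
    H.edgeSet.ncard ≤ binaryEdgeCount (2 ^ n - g) := by
  classical
  have := h.finite
  have := Fintype.ofFinite V
  have := Fintype.ofFinite H.ConnectedComponent
  let S (c : H.ConnectedComponent) : Finset V := {v | H.connectedComponentMk v = c}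
  have hpos (c) : 1 ≤ #(S c) := by
    induction c using SimpleGraph.ConnectedComponent.ind with
    | _ v => exact card_pos.mpr ⟨v, by simp [S]⟩
  have hcard : ∑ c, #(S c) = 2 ^ n := by
    rw [← h.card_eq, Nat.card_eq_fintype_card, ← card_univ]
    exact (card_eq_sum_card_fiberwise (by simp)).symm
  have hsplit : adjPairs H univ ≤ ∑ c, adjPairs G (S c) := by
    unfold adjPairs
    rw [← sum_fiberwise univ H.connectedComponentMk]
    refine sum_le_sum fun c _ => sum_le_sum fun u hu => ?_
    rw [← card_filter, ← card_filter]
    refine card_le_card fun v hv => ?_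
    simp only [mem_filter, mem_univ, true_and, S] at hu hv ⊢
    exact ⟨by rw [← hu]; exact (SimpleGraph.ConnectedComponent.sound hv.reachable).symm, hH hv⟩
  have hbound : ∑ c, adjPairs G (S c) ≤ 2 * ∑ c, binaryEdgeCount (#(S c) - 1 + 1) := by
    rw [mul_sum]
    refine sum_le_sum fun c _ => ?_
    rw [Nat.sub_add_cancel (hpos c)]
    exact h.adjPairs_le _
  have hsum : ∑ c, (#(S c) - 1) + Nat.card H.ConnectedComponent = 2 ^ n := by
    rw [← hcard, Nat.card_eq_fintype_card, ← card_univ, card_eq_sum_ones, ← sum_add_distrib]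
    exact sum_congr rfl fun c _ => Nat.sub_add_cancel (hpos c)
  have hconc := sum_binaryEdgeCount_succ_le univ fun c => #(S c) - 1
  have hmono : binaryEdgeCount (∑ c, (#(S c) - 1) + 1) ≤ binaryEdgeCount (2 ^ n - g) :=
    binaryEdgeCount_mono (by omega)
  rw [adjPairs_univ] at hsplit
  omega

/-- The edge cut isolating all vertices outside an optimal set of `2 ^ n - g` vertices. -/
lemma IsHL.exists_isComponentEdgeCut {n : ℕ} {V : Type*} {G : SimpleGraph V} (h : IsHL n G)
    {g : ℕ} (hg : g < 2 ^ n) : ∃ F : Set (Sym2 V), IsComponentEdgeCut G (g + 1) F ∧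
      binaryEdgeCount (2 ^ n - g) + F.ncard = binaryEdgeCount (2 ^ n) := by
  classical
  have := h.finite
  have := Fintype.ofFinite V
  obtain ⟨Y, hY, hY'⟩ := h.exists_adjPairs_eq (Nat.sub_le (2 ^ n) g)
  let H : SimpleGraph V :=
    { Adj u v := G.Adj u v ∧ u ∈ Y ∧ v ∈ Y
      symm := ⟨fun _ _ h => ⟨h.1.symm, h.2.2, h.2.1⟩⟩
      loopless := ⟨fun _ h => h.1.ne rfl⟩ }
  have hle : H ≤ G := fun _ _ h => h.1
  have hdel : G.deleteEdges (G.edgeSet \ H.edgeSet) = H := by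
    ext u v
    simp only [SimpleGraph.deleteEdges_adj, Set.mem_sdiff, SimpleGraph.mem_edgeSet]
    have := @hle u v
    tauto
  have hpairs : adjPairs H univ = adjPairs G Y := by
    unfold adjPairs
    refine (sum_subset (subset_univ Y) fun u _ hu =>
      sum_eq_zero fun v _ => if_neg fun huv => hu huv.2.1).symm.trans ?_
    refine sum_congr rfl fun u hu => ?_
    refine (sum_subset (subset_univ Y) fun v _ hv => if_neg fun huv => hv huv.2.2).symm.trans ?_
    exact sum_congr rfl fun v hv => by simp only [H, hu, hv, and_true]
  have hF := ncard_edgeSet_deleteEdges_add G (Set.sdiff_subset : G.edgeSet \ H.edgeSet ⊆ _)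
  refine ⟨G.edgeSet \ H.edgeSet, ⟨Set.sdiff_subset, ?_⟩, ?_⟩
  · rw [hdel]
    have hiso {u v : V} (hu : u ∉ Y) (huv : H.Reachable u v) : u = v := by
      obtain ⟨p⟩ := huv
      cases p with
      | nil => rfl
      | cons hadj _ => exact absurd hadj.2.1 hu
    obtain ⟨y, hy⟩ : Y.Nonempty := card_pos.mp (by omega)
    have hcard : #(insert y Yᶜ) = g + 1 := by
      rw [card_insert_of_notMem (by simpa using hy), card_compl, hY,
        ← Nat.card_eq_fintype_card, h.card_eq]
      omega
    have := Fintype.ofFinite H.ConnectedComponent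
    rw [Nat.card_eq_fintype_card, ← hcard, ← card_univ]
    refine card_le_card_of_injOn H.connectedComponentMk (by simp [Set.MapsTo]) ?_
    intro u hu v hv huv
    have huv := SimpleGraph.ConnectedComponent.exact huv
    simp only [coe_insert, Set.mem_insert_iff, mem_coe, mem_compl] at hu hv
    rcases hu with rfl | hu
    · rcases hv with rfl | hv
      · rfl
      · exact (hiso hv huv.symm).symm
    · exact hiso hu huv
  · rw [hdel, h.ncard_edgeSet] at hF
    rw [adjPairs_univ] at hpairs
    omega

lemma IsHL.componentEdgeConnectivity_add {n : ℕ} {V : Type*} {G : SimpleGraph V} (h : IsHL n G)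
    {g : ℕ} (hg : g < 2 ^ n) :
    componentEdgeConnectivity G (g + 1) + binaryEdgeCount g = n * g := by
  have := h.finite
  obtain ⟨⟨F, hF, hF'⟩, hmin⟩ :=
    componentEdgeConnectivity_isLeast G (k := g + 1) (by rw [h.card_eq]; omega)
  obtain ⟨F₀, hF₀, hF₀'⟩ := h.exists_isComponentEdgeCut hg
  have hupper := hmin ⟨F₀, hF₀, rfl⟩
  have hlower := h.ncard_edgeSet_le_of_lt_card_components (G.deleteEdges_le F) hF.2
  have hsum := ncard_edgeSet_deleteEdges_add G hF.1
  rw [h.ncard_edgeSet] at hsum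
  have hrefl := binaryEdgeCount_reflect n hg.le
  omega

end HLNetwork

theorem theorem3p2 {V : Type*} (n g : ℕ) (hn : 8 ≤ n) (hg : g ≤ 2 ^ ⌈(n : ℚ) / 2⌉₊)
    (G : SimpleGraph V) (hG : HLNetwork.IsHL n G) :
    (HLNetwork.componentEdgeConnectivity G (g + 1) : ℤ) =
        (n : ℤ) * (g : ℤ) - (HLNetwork.maxInducedEdges G g : ℤ) ∧
      HLNetwork.maxInducedEdges G g = HLNetwork.binaryEdgeCount g := by
  have hceil : ⌈(n : ℚ) / 2⌉₊ ≤ n - 1 := by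
    have : (8 : ℚ) ≤ n := by exact_mod_cast hn
    rw [Nat.ceil_le, Nat.cast_sub (by omega)]
    push_cast
    linarith
  have hlt : g < 2 ^ n :=
    hg.trans_lt (Nat.pow_lt_pow_right (by norm_num) (by omega))
  have h1 := hG.maxInducedEdges_eq hlt.le
  refine ⟨?_, h1⟩
  have h2 := hG.componentEdgeConnectivity_add hlt
  rw [h1, eq_sub_iff_add_eq]
  exact_mod_cast h2
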